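/- Let $m\ge 1$, let $x\in\mathbb{R}^m$, $x\neq 0$, and let $f$ be a real-valued function on $\mathbb{R}^m$ that is differentiable in a neighbourhood of $x$, with $f(x)\neq 0$ and $\nabla f(x)\neq 0$. With the Euclidean norm, put $\mathcal{P}(x,\delta)=\{x'\in\mathbb{R}^m : \|x'-x\|\le \delta\|x\|\}$, let $x'\sim\mathcal{P}(x,\delta)$ mean that $x'$ is uniformly distributed in this ball, let $\log$ be the logarithm with base $2$ and $\ln$ the natural logarithm (with base $e$), and define $$\mathrm{WNC}(x)=\lim_{\delta\to0^+}\ \sup_{x'\in\mathcal{P}(x,\delta)}\frac{|f(x')-f(x)|}{\delta|f(x)|},\qquad \mathrm{SNC}(x)=\lim_{\delta\to0^+}\ \mathop{\mathbb{E}}_{x'\sim\mathcal{P}(x,\delta)}\frac{|f(x')-f(x)|}{\delta|f(x)|},$$ $$\mathrm{SNLP}(x)=\lim_{\delta\to0^+}\ \mathop{\mathbb{E}}_{x'\sim\mathcal{P}(x,\delta)}\log\frac{|f(x')-f(x)|}{\delta|f(x)|}.$$ Then the limits $\mathrm{WNC}(x)$ and $\mathrm{SNC}(x)$ exist and are finite,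 $\mathrm{WNC}(x)>0$, and $$\frac{\mathrm{SNC}(x)}{\mathrm{WNC}(x)}=\begin{cases}\dfrac{m(m-2)\cdots 1}{(m+1)(m-1)\cdots 2} & \text{if } m \text{ is odd},\\[2ex] \dfrac{m(m-2)\cdots 2}{(m+1)(m-1)\cdots 1}\cdot\dfrac{2}{\pi} & \text{if } m \text{ is even}.\end{cases}$$ If moreover $\nabla f$ is continuous at $x$, then for all small $\delta>0$ one has $f(x')\ne f(x)$ almost surely and the expectation of the logarithm is finite, the limit $\mathrm{SNLP}(x)$ exists and is finite, and $$\frac{\mathrm{SNLP}(x)-\log \mathrm{WNC}(x)}{\log e}=\begin{cases}-\dfrac1m-\dfrac1{m-2}-\cdots-\dfrac13-1 & \text{if } m \text{ is odd},\\[2ex] -\dfrac1m-\dfrac1{m-2}-\cdots-\dfrac12-\ln 2 & \text{if } m \text{ is even}.\end{cases}$$ -/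

import Mathlib

open Filter Topology MeasureTheory
open scoped Nat

namespace CondNumber

noncomputable section

/-- The set of norm-wise perturbations of `x` of relative size at most `δ`
(Euclidean norm on `ℝ^m`). -/
def perturbations {m : ℕ} (x : EuclideanSpace ℝ (Fin m)) (δ : ℝ) :
    Set (EuclideanSpace ℝ (Fin m)) :=
  {x' | ‖x' - x‖ ≤ δ * ‖x‖}

/-- The uniform distribution on `perturbations x δ`: normalized Lebesgue measure. -/
def uniformPerturbation {m : ℕ} (x : EuclideanSpace ℝ (Fin m)) (δ : ℝ) :
    Measure (EuclideanSpace ℝ (Fin m)) :=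
  ProbabilityTheory.cond volume (perturbations x δ)

/-- The relative error of the output, divided by `δ`. -/
def relError {m : ℕ} {F : Type*} [NormedAddCommGroup F]
    (f : EuclideanSpace ℝ (Fin m) → F) (x : EuclideanSpace ℝ (Fin m)) (δ : ℝ)
    (x' : EuclideanSpace ℝ (Fin m)) : ℝ :=
  ‖f x' - f x‖ / (δ * ‖f x‖)

/-- `W` is the worst-case norm-wise condition number of `f` at `x`: the limit defining it exists
and equals the real number `W`. The supremum is taken in the extended reals. -/
def HasWNC {m : ℕ} {F : Type*} [NormedAddCommGroup F]
    (f : EuclideanSpace ℝ (Fin m) → F) (x : EuclideanSpace ℝ (Fin m)) (W : ℝ) : Prop :=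
  Tendsto (fun δ : ℝ => ⨆ x' ∈ perturbations x δ, (relError f x δ x' : EReal))
    (𝓝[>] 0) (𝓝 (W : EReal))

/-- `S` is the stochastic norm-wise condition number of `f` at `x`: the expectations exist for all
small `δ > 0` and converge to `S`. -/
def HasSNC {m : ℕ} {F : Type*} [NormedAddCommGroup F]
    (f : EuclideanSpace ℝ (Fin m) → F) (x : EuclideanSpace ℝ (Fin m)) (S : ℝ) : Prop :=
  (∀ᶠ δ : ℝ in 𝓝[>] 0, Integrable (relError f x δ) (uniformPerturbation x δ)) ∧
  Tendsto (fun δ : ℝ => ∫ x', relError f x δ x' ∂(uniformPerturbation x δ)) (𝓝[>] 0) (𝓝 S)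

/-- `L` is the stochastic norm-wise loss of precision (in bits) of `f` at `x`: for all small
`δ > 0` the logarithm is almost surely that of a nonzero number and has a finite expectation,
and these expectations converge to `L`. -/
def HasSNLP {m : ℕ} {F : Type*} [NormedAddCommGroup F]
    (f : EuclideanSpace ℝ (Fin m) → F) (x : EuclideanSpace ℝ (Fin m)) (L : ℝ) : Prop :=
  (∀ᶠ δ : ℝ in 𝓝[>] 0,
    (∀ᵐ x' ∂(uniformPerturbation x δ), relError f x δ x' ≠ 0) ∧
    Integrable (fun x' => Real.logb 2 (relError f x δ x')) (uniformPerturbation x δ)) ∧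
  Tendsto (fun δ : ℝ => ∫ x', Real.logb 2 (relError f x δ x') ∂(uniformPerturbation x δ))
    (𝓝[>] 0) (𝓝 L)

end

end CondNumber

/-! Rescale the set of perturbations to the unit ball: with x' = x + δ‖x‖u, the relative error
divided by δ is |G_δ(u)|, and as δ → 0 the functions G_δ (`scaledError`) tend uniformly to the
linear functional ℓ = (‖x‖ / f x) • f'(x). Hence WNC = ‖ℓ‖, SNC = E|ℓ u| and SNLP = E log₂|ℓ u| with
u uniform in the ball. By rotation invariance ℓ u is distributed as ‖ℓ‖u₀. Slicing the ball and
putting u₀ = sin θ gives the density cos^m θ up to a constant, so both means are ratios of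
trigonometric integrals with two-step recurrences in m (`absMean_add_two`, `logMean_add_two`). The
bases m = 1 and m = 0 produce the two parities. The delicate limit is the logarithmic one, since log
is unbounded near the zeros of G_δ. Continuity of the gradient makes G_δ − ℓ Lipschitz with a small
constant. Then the law of G_δ is at most a constant times the law of 2ℓ
(`exists_measure_preimage_le`), which controls the logarithmic tails uniformly in δ
(`tendsto_integral_log`). -/

namespace CondNumber

/-! ### Trigonometric integrals and their recurrences. -/

section Trigonometric

open Real

theorem integral_symm_cos_pow_pos (m : ℕ) : 0 < ∫ θ in (-(π / 2))..(π / 2), cos θ ^ m := by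
  refine intervalIntegral.intervalIntegral_pos_of_pos_on
    (Continuous.intervalIntegrable (by fun_prop) _ _) (fun θ hθ => pow_pos (cos_pos_of_mem_Ioo hθ) m)
    (by linarith [pi_pos])

theorem integral_symm_cos_pow_add_two (m : ℕ) :
    ∫ θ in (-(π / 2))..(π / 2), cos θ ^ (m + 2) =
      (m + 1) / (m + 2) * ∫ θ in (-(π / 2))..(π / 2), cos θ ^ m := by
  rw [integral_cos_pow]
  simp

theorem integral_symm_abs_sin_mul_cos_pow (m : ℕ) :
    ∫ θ in (-(π / 2))..(π / 2), |sin θ| * cos θ ^ m = 2 / (m + 1) := by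
  have hm : (m : ℝ) + 1 ≠ 0 := by positivity
  have hi (a b : ℝ) : IntervalIntegrable (fun θ => |sin θ| * cos θ ^ m) volume a b :=
    Continuous.intervalIntegrable (by fun_prop) _ _
  have half : ∫ θ in (0 : ℝ)..(π / 2), |sin θ| * cos θ ^ m = 1 / (m + 1) := by
    have h1 : ∫ θ in (0 : ℝ)..(π / 2), |sin θ| * cos θ ^ m =
        ∫ θ in (0 : ℝ)..(π / 2), sin θ * cos θ ^ m := by
      refine intervalIntegral.integral_congr fun θ hθ => ?_
      rw [Set.uIcc_of_le (by positivity)] at hθ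
      simp only [abs_of_nonneg (sin_nonneg_of_nonneg_of_le_pi hθ.1 (by linarith [hθ.2, pi_pos]))]
    have hd : ∀ θ ∈ Set.uIcc 0 (π / 2),
        HasDerivAt (fun θ => -(cos θ ^ (m + 1) / (m + 1))) (sin θ * cos θ ^ m) θ := by
      intro θ _
      refine (((hasDerivAt_cos θ).pow (m + 1)).div_const ((m : ℝ) + 1)).neg.congr_deriv ?_
      push_cast
      field_simp
    rw [h1, intervalIntegral.integral_eq_sub_of_hasDerivAt hd
      (Continuous.intervalIntegrable (by fun_prop) _ _)]
    simp
  have half' : ∫ θ in (-(π / 2))..0, |sin θ| * cos θ ^ m = 1 / (m + 1) := by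
    rw [← half]
    have := intervalIntegral.integral_comp_neg (a := 0) (b := π / 2)
      (fun θ => |sin θ| * cos θ ^ m)
    simpa using this.symm
  rw [← intervalIntegral.integral_add_adjacent_intervals (hi _ 0) (hi 0 _), half, half']
  ring

theorem intervalIntegrable_log_sin_mul_cos_pow (m : ℕ) (a b : ℝ) :
    IntervalIntegrable (fun θ => log (sin θ) * cos θ ^ m) volume a b :=
  IntervalIntegrable.mul_continuousOn (f := fun θ => log (sin θ)) intervalIntegrable_log_sin
    (by fun_prop)

/-- `Real.log` ignores signs, so the integrand has period π and the known integral over [0, π]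
applies. -/
theorem integral_symm_log_sin : ∫ θ in (-(π / 2))..(π / 2), log (sin θ) = -log 2 * π := by
  have hp : Function.Periodic (fun θ => log (sin θ)) π := by
    intro θ
    simp
  have h := hp.intervalIntegral_add_eq (-(π / 2)) 0
  rw [zero_add, integral_log_sin_zero_pi] at h
  rw [← h]
  congr 1
  ring

theorem integral_symm_log_sin_mul_cos :
    ∫ θ in (-(π / 2))..(π / 2), log (sin θ) * cos θ = -2 := by
  -- The primitive is continuous even at 0, where log (sin θ) is singular; the fundamental theorem
  -- allows this one exceptional point.
  have h := integral_eq_of_hasDerivAt_off_countable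
    (fun θ => sin θ * log (sin θ) - sin θ) (fun θ => log (sin θ) * cos θ)
    (a := -(π / 2)) (b := π / 2) (Set.countable_singleton 0)
    ((continuous_mul_log.comp continuous_sin).sub continuous_sin).continuousOn ?_
    (by simpa using intervalIntegrable_log_sin_mul_cos_pow 1 _ _)
  · rw [h]
    simp
    norm_num
  · rintro θ ⟨hθ, h0⟩
    rw [min_eq_left (by linarith [pi_pos]), max_eq_right (by linarith [pi_pos])] at hθ
    have hs : sin θ ≠ 0 := by
      rw [Ne, sin_eq_zero_iff_of_lt_of_lt (by linarith [hθ.1, pi_pos]) (by linarith [hθ.2, pi_pos])]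
      exact h0
    refine (((hasDerivAt_mul_log hs).comp θ (hasDerivAt_sin θ)).sub
      (hasDerivAt_sin θ)).congr_deriv ?_
    ring

/-- Integrate the derivative of sin θ · log (sin θ) · cos^(m+1) θ, which vanishes at both endpoints,
and replace sin² by 1 − cos². -/
theorem integral_symm_log_sin_mul_cos_pow_add_two (m : ℕ) :
    (m + 2) * ∫ θ in (-(π / 2))..(π / 2), log (sin θ) * cos θ ^ (m + 2) =
      (m + 1) * (∫ θ in (-(π / 2))..(π / 2), log (sin θ) * cos θ ^ m) -
        ∫ θ in (-(π / 2))..(π / 2), cos θ ^ (m + 2) := by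
  have i1 := (intervalIntegrable_log_sin_mul_cos_pow (m + 2) (-(π / 2)) (π / 2)).const_mul
    ((m : ℝ) + 2)
  have i2 := (intervalIntegrable_log_sin_mul_cos_pow m (-(π / 2)) (π / 2)).const_mul ((m : ℝ) + 1)
  have i3 : IntervalIntegrable (fun θ => cos θ ^ (m + 2)) volume (-(π / 2)) (π / 2) :=
    Continuous.intervalIntegrable (by fun_prop) _ _
  have h := integral_eq_of_hasDerivAt_off_countable
    (fun θ => sin θ * log (sin θ) * cos θ ^ (m + 1))
    (fun θ => ((m + 2) * (log (sin θ) * cos θ ^ (m + 2)) - (m + 1) * (log (sin θ) * cos θ ^ m))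
      + cos θ ^ (m + 2))
    (a := -(π / 2)) (b := π / 2) (Set.countable_singleton 0)
    ((continuous_mul_log.comp continuous_sin).mul (by fun_prop)).continuousOn ?_
    ((i1.sub i2).add i3)
  · rw [intervalIntegral.integral_add (i1.sub i2) i3, intervalIntegral.integral_sub i1 i2,
      intervalIntegral.integral_const_mul, intervalIntegral.integral_const_mul] at h
    simp only [sin_pi_div_two, log_one, mul_zero, cos_neg, cos_pi_div_two, ne_eq,
      Nat.add_eq_zero_iff, one_ne_zero, and_false, not_false_eq_true, zero_pow, sub_self] at h
    linarith
  · rintro θ ⟨hθ, h0⟩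
    rw [min_eq_left (by linarith [pi_pos]), max_eq_right (by linarith [pi_pos])] at hθ
    have hs : sin θ ≠ 0 := by
      rw [Ne, sin_eq_zero_iff_of_lt_of_lt (by linarith [hθ.1, pi_pos]) (by linarith [hθ.2, pi_pos])]
      exact h0
    refine (((hasDerivAt_mul_log hs).comp θ (hasDerivAt_sin θ)).mul
      ((hasDerivAt_cos θ).pow (m + 1))).congr_deriv ?_
    push_cast
    simp only [Function.comp_apply, Pi.pow_apply]
    linear_combination (-(m + 1) * cos θ ^ m * log (sin θ)) * sin_sq θ

/-- The mean of `|⟪u, e⟫|` for a unit vector `e` and `u` uniform in the unit ball of `ℝ^m`. -/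
noncomputable def absMean (m : ℕ) : ℝ :=
  (∫ θ in (-(π / 2))..(π / 2), |sin θ| * cos θ ^ m) / ∫ θ in (-(π / 2))..(π / 2), cos θ ^ m

/-- The mean of `log |⟪u, e⟫|` for a unit vector `e` and `u` uniform in the unit ball of `ℝ^m`. -/
noncomputable def logMean (m : ℕ) : ℝ :=
  (∫ θ in (-(π / 2))..(π / 2), log (sin θ) * cos θ ^ m) / ∫ θ in (-(π / 2))..(π / 2), cos θ ^ m

theorem absMean_add_two (m : ℕ) : absMean (m + 2) = (m + 2) / (m + 3) * absMean m := by
  have hA := (integral_symm_cos_pow_pos m).ne'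
  rw [absMean, absMean, integral_symm_abs_sin_mul_cos_pow, integral_symm_abs_sin_mul_cos_pow,
    integral_symm_cos_pow_add_two]
  push_cast
  have h1 : (m : ℝ) + 1 ≠ 0 := by positivity
  have h2 : (m : ℝ) + 2 ≠ 0 := by positivity
  have h3 : (m : ℝ) + 3 ≠ 0 := by positivity
  have h3' : (m : ℝ) + 2 + 1 ≠ 0 := by positivity
  field_simp
  ring

theorem logMean_add_two (m : ℕ) : logMean (m + 2) = logMean m - 1 / (m + 2) := by
  have hA := (integral_symm_cos_pow_pos m).ne'
  have h1 : (m : ℝ) + 1 ≠ 0 := by positivity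
  have h2 : (m : ℝ) + 2 ≠ 0 := by positivity
  have h := integral_symm_log_sin_mul_cos_pow_add_two m
  rw [integral_symm_cos_pow_add_two] at h
  rw [logMean, logMean, integral_symm_cos_pow_add_two]
  generalize (∫ θ in (-(π / 2))..(π / 2), log (sin θ) * cos θ ^ (m + 2)) = X at *
  obtain rfl : X = ((m + 1) * (∫ θ in (-(π / 2))..(π / 2), log (sin θ) * cos θ ^ m) -
    (m + 1) / (m + 2) * ∫ θ in (-(π / 2))..(π / 2), cos θ ^ m) / (m + 2) := by
    rw [← h]
    field_simp
  field_simp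

/-- There is no unit vector in dimension 0; this value of the formula only starts the even
recurrence. -/
theorem absMean_zero : absMean 0 = 2 / π := by
  rw [absMean, integral_symm_abs_sin_mul_cos_pow]
  simp

theorem absMean_one : absMean 1 = 1 / 2 := by
  rw [absMean, integral_symm_abs_sin_mul_cos_pow]
  simp
  norm_num

theorem logMean_zero : logMean 0 = -log 2 := by
  have := pi_ne_zero
  simp only [logMean, pow_zero, mul_one, integral_symm_log_sin]
  simp
  field_simp

theorem logMean_one : logMean 1 = -1 := by
  simp only [logMean, pow_one, integral_symm_log_sin_mul_cos]
  simp
  norm_num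

theorem absMean_of_odd {m : ℕ} (hm : Odd m) : absMean m = (m‼ : ℝ) / ((m + 1)‼ : ℝ) := by
  obtain ⟨k, rfl⟩ := hm
  induction k with
  | zero => simp [absMean_one, Nat.doubleFactorial]
  | succ k ih =>
    have e : 2 * (k + 1) + 1 = 2 * k + 1 + 2 := by ring
    rw [e, absMean_add_two, ih, Nat.doubleFactorial_add_two (2 * k + 1),
      show 2 * k + 1 + 2 + 1 = (2 * k + 1 + 1) + 2 by ring,
      Nat.doubleFactorial_add_two (2 * k + 1 + 1)]
    push_cast
    rw [div_mul_div_comm]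
    ring

theorem absMean_of_even {m : ℕ} (hm : Even m) :
    absMean m = (m‼ : ℝ) / ((m + 1)‼ : ℝ) * (2 / π) := by
  obtain ⟨k, rfl⟩ := hm
  rw [← two_mul]
  induction k with
  | zero => simp [absMean_zero, Nat.doubleFactorial]
  | succ k ih =>
    have e : 2 * (k + 1) = 2 * k + 2 := by ring
    rw [e, absMean_add_two, ih, Nat.doubleFactorial_add_two,
      show 2 * k + 2 + 1 = (2 * k + 1) + 2 by ring, Nat.doubleFactorial_add_two]
    push_cast
    rw [← mul_assoc, div_mul_div_comm]
    ring

theorem logMean_of_odd {m : ℕ} (hm : Odd m) :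
    logMean m = -∑ k ∈ (Finset.Icc 1 m).filter Odd, 1 / (k : ℝ) := by
  obtain ⟨k, rfl⟩ := hm
  induction k with
  | zero => simp [logMean_one, Finset.sum_filter]
  | succ k ih =>
    have e : 2 * (k + 1) + 1 = 2 * k + 1 + 1 + 1 := by ring
    rw [Finset.sum_filter] at ih
    rw [e, logMean_add_two, ih, Finset.sum_filter,
      Finset.sum_Icc_succ_top (b := 2 * k + 1 + 1) (by lia),
      Finset.sum_Icc_succ_top (b := 2 * k + 1) (by lia), if_neg (by grind), if_pos (by grind)]
    push_cast
    ring

theorem logMean_of_even {m : ℕ} (hm : Even m) :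
    logMean m = -(∑ k ∈ (Finset.Icc 1 m).filter Even, 1 / (k : ℝ)) - log 2 := by
  obtain ⟨k, rfl⟩ := hm
  rw [← two_mul]
  induction k with
  | zero => simp [logMean_zero]
  | succ k ih =>
    have e : 2 * (k + 1) = 2 * k + 1 + 1 := by ring
    rw [Finset.sum_filter] at ih
    rw [e, logMean_add_two, ih, Finset.sum_filter, Finset.sum_Icc_succ_top (by lia),
      Finset.sum_Icc_succ_top (by lia), if_neg (by grind), if_pos (by grind)]
    push_cast
    ring

end Trigonometric

end CondNumber

namespace CondNumber

/-! ### The law of one coordinate of a uniform point of the ball. -/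

section Slicing

open Real Set
open scoped ENNReal

theorem volume_setOf_sum_sq_le (n : ℕ) {r : ℝ} (hr : 0 ≤ r) :
    volume {y : Fin n → ℝ | ∑ i, y i ^ 2 ≤ r ^ 2} =
      ENNReal.ofReal (r ^ n) * volume (Metric.ball (0 : EuclideanSpace ℝ (Fin n)) 1) := by
  have h := Measure.addHaar_closedBall volume (0 : EuclideanSpace ℝ (Fin n)) hr
  rw [finrank_euclideanSpace_fin] at h
  rw [← h,
    ← (EuclideanSpace.volume_preserving_symm_measurableEquiv_toLp (Fin n)).measure_preimage_equiv]
  congr 1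
  ext y
  simp only [mem_preimage, mem_ofPred_eq, mem_closedBall_zero_iff]
  rw [EuclideanSpace.norm_eq, Real.sqrt_le_left hr]
  simp

/-- By Fubini, the slice at height t = sin θ is an n-ball of radius cos θ; the Jacobian of the
substitution supplies one more factor cos θ. -/
theorem lintegral_closedBall_coord (n : ℕ) {h : ℝ → ℝ≥0∞} (hh : Measurable h) :
    ∫⁻ u in Metric.closedBall (0 : EuclideanSpace ℝ (Fin (n + 1))) 1, h (u 0) =
      volume (Metric.ball (0 : EuclideanSpace ℝ (Fin n)) 1) *
        ∫⁻ θ in Ioo (-(π / 2)) (π / 2), ENNReal.ofReal (cos θ ^ (n + 1)) * h (sin θ) := by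
  have hmp := (volume_preserving_piFinSuccAbove (fun _ : Fin (n + 1) => ℝ) 0).comp
    (EuclideanSpace.volume_preserving_symm_measurableEquiv_toLp (Fin (n + 1)))
  let S : Set (ℝ × (Fin n → ℝ)) := {p | p.1 ^ 2 + ∑ i, p.2 i ^ 2 ≤ 1}
  have hS : MeasurableSet S := measurableSet_le (by fun_prop) (by fun_prop)
  have hm : Measurable (S.indicator fun p => h p.1) := (hh.comp measurable_fst).indicator hS
  have e1 : ∫⁻ u in Metric.closedBall (0 : EuclideanSpace ℝ (Fin (n + 1))) 1, h (u 0) =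
      ∫⁻ p, S.indicator (fun p => h p.1) p := by
    rw [← hmp.lintegral_comp hm, ← lintegral_indicator measurableSet_closedBall]
    refine lintegral_congr fun u => ?_
    have hu : u ∈ Metric.closedBall (0 : EuclideanSpace ℝ (Fin (n + 1))) 1 ↔
        (MeasurableEquiv.piFinSuccAbove (fun _ : Fin (n + 1) => ℝ) 0
          ((MeasurableEquiv.toLp 2 (Fin (n + 1) → ℝ)).symm u)) ∈ S := by
      rw [mem_closedBall_zero_iff, EuclideanSpace.norm_eq, Real.sqrt_le_left zero_le_one,
        Fin.sum_univ_succ]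
      simp [S, MeasurableEquiv.piFinSuccAbove, Fin.tail]
    by_cases h1 : u ∈ Metric.closedBall (0 : EuclideanSpace ℝ (Fin (n + 1))) 1
    · rw [indicator_of_mem h1, Function.comp_apply, indicator_of_mem (hu.1 h1)]
      rfl
    · rw [indicator_of_notMem h1, Function.comp_apply, indicator_of_notMem (mt hu.2 h1)]
  let F : ℝ → ℝ≥0∞ := fun t => h t * volume {y : Fin n → ℝ | t ^ 2 + ∑ i, y i ^ 2 ≤ 1}
  have e2 : ∫⁻ p, S.indicator (fun p => h p.1) p = ∫⁻ t, F t := by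
    rw [Measure.volume_eq_prod, lintegral_prod _ hm.aemeasurable]
    refine lintegral_congr fun t => ?_
    have : (fun y : Fin n → ℝ => S.indicator (fun p => h p.1) (t, y)) =
        {y : Fin n → ℝ | t ^ 2 + ∑ i, y i ^ 2 ≤ 1}.indicator fun _ => h t := rfl
    rw [this, lintegral_indicator_const (measurableSet_le (by fun_prop) (by fun_prop))]
  -- Slices with |t| > 1 are empty. Dropping the null endpoints gives exactly the image of the open
  -- interval under sin.
  have e3 : ∫⁻ t, F t = ∫⁻ t in Ioo (-1) 1, F t := by
    rw [setLIntegral_congr (Ioo_ae_eq_Icc (a := (-1 : ℝ)) (b := 1)),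
      setLIntegral_eq_of_support_subset]
    intro t ht
    by_contra hcon
    refine ht ?_
    have : {y : Fin n → ℝ | t ^ 2 + ∑ i, y i ^ 2 ≤ 1} = ∅ := by
      rw [eq_empty_iff_forall_notMem]
      intro y hy
      refine hcon (abs_le.1 ?_)
      rw [← sq_le_one_iff_abs_le_one]
      have := Finset.sum_nonneg (s := Finset.univ) fun i _ => sq_nonneg (y i)
      exact le_trans (by linarith) (mem_ofPred_eq ▸ hy)
    simp [F, this]
  have himg : sin '' Ioo (-(π / 2)) (π / 2) = Ioo (-1) 1 := by
    ext t
    constructor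
    · rintro ⟨θ, hθ, rfl⟩
      have hc := cos_pos_of_mem_Ioo hθ
      rw [mem_Ioo, ← abs_lt, ← sq_lt_one_iff_abs_lt_one, sin_sq]
      nlinarith
    · rintro ⟨h1, h2⟩
      exact ⟨arcsin t, ⟨neg_pi_div_two_lt_arcsin.2 h1, arcsin_lt_pi_div_two.2 h2⟩,
        sin_arcsin h1.le h2.le⟩
  rw [e1, e2, e3, ← himg, lintegral_image_eq_lintegral_abs_deriv_mul measurableSet_Ioo
    (fun θ _ => (hasDerivAt_sin θ).hasDerivWithinAt)
    (strictMonoOn_sin.injOn.mono Ioo_subset_Icc_self), ← lintegral_const_mul]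
  · refine setLIntegral_congr_fun measurableSet_Ioo fun θ hθ => ?_
    have hc : 0 < cos θ := cos_pos_of_mem_Ioo hθ
    have hset : {y : Fin n → ℝ | sin θ ^ 2 + ∑ i, y i ^ 2 ≤ 1} =
        {y : Fin n → ℝ | ∑ i, y i ^ 2 ≤ cos θ ^ 2} := by
      ext y
      simp only [mem_ofPred_eq, cos_sq']
      constructor <;> intro <;> linarith
    simp only [F, hset, volume_setOf_sum_sq_le n hc.le, abs_of_pos hc]
    rw [pow_succ, ENNReal.ofReal_mul (by positivity)]
    ring
  · fun_prop

/-- Rotation invariance: extend e to an orthonormal basis with e at index 0; its coordinate map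
preserves volume and the ball. -/
theorem lintegral_closedBall_inner (n : ℕ) {e : EuclideanSpace ℝ (Fin (n + 1))} (he : ‖e‖ = 1)
    {h : ℝ → ℝ≥0∞} (hh : Measurable h) :
    ∫⁻ u in Metric.closedBall (0 : EuclideanSpace ℝ (Fin (n + 1))) 1, h (inner ℝ e u) =
      volume (Metric.ball (0 : EuclideanSpace ℝ (Fin n)) 1) *
        ∫⁻ θ in Ioo (-(π / 2)) (π / 2), ENNReal.ofReal (cos θ ^ (n + 1)) * h (sin θ) := by
  obtain ⟨b, hb⟩ := Orthonormal.exists_orthonormalBasis_extension_of_card_eq (𝕜 := ℝ)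
    (E := EuclideanSpace ℝ (Fin (n + 1))) (ι := Fin (n + 1)) (by simp) (v := fun _ => e) (s := {0})
    (by
      rw [orthonormal_iff_ite]
      rintro ⟨i, rfl⟩ ⟨j, rfl⟩
      simp [he])
  rw [← lintegral_closedBall_coord n hh, ← b.measurePreserving_repr.setLIntegral_comp_preimage
    (f := fun u => h (u 0)) measurableSet_closedBall (by fun_prop)]
  have hpre : b.repr ⁻¹' Metric.closedBall 0 1 = Metric.closedBall 0 1 := by
    ext u
    simp
  rw [hpre]
  refine lintegral_congr fun u => ?_
  rw [b.repr_apply_apply, hb 0 rfl]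

/-- The uniform distribution on the closed unit ball. -/
noncomputable def ballUniform (m : ℕ) : Measure (EuclideanSpace ℝ (Fin m)) :=
  ProbabilityTheory.cond volume (Metric.closedBall 0 1)

instance (m : ℕ) : IsProbabilityMeasure (ballUniform m) :=
  ProbabilityTheory.cond_isProbabilityMeasure_of_finite
    (Metric.measure_closedBall_pos _ _ one_pos).ne' measure_closedBall_lt_top.ne

theorem exists_map_inner_ballUniform (n : ℕ) :
    ∃ c : ℝ≥0∞, c ≠ ∞ ∧ ∀ e : EuclideanSpace ℝ (Fin (n + 1)), ‖e‖ = 1 →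
      (ballUniform (n + 1)).map (fun u => inner ℝ e u) =
        c • ((volume.restrict (Ioo (-(π / 2)) (π / 2))).withDensity
          fun θ => ENNReal.ofReal (cos θ ^ (n + 1))).map sin := by
  refine ⟨(volume (Metric.closedBall (0 : EuclideanSpace ℝ (Fin (n + 1))) 1))⁻¹ *
    volume (Metric.ball (0 : EuclideanSpace ℝ (Fin n)) 1), ?_, fun e he => ?_⟩
  · exact ENNReal.mul_ne_top (ENNReal.inv_ne_top.2 (Metric.measure_closedBall_pos _ _ one_pos).ne')
      measure_ball_lt_top.ne
  · refine Measure.ext_of_lintegral _ fun h hh => ?_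
    rw [lintegral_map hh (by fun_prop), lintegral_smul_measure, lintegral_map hh (by fun_prop),
      lintegral_withDensity_eq_lintegral_mul _ (by fun_prop) (by fun_prop), ballUniform,
      ProbabilityTheory.cond, lintegral_smul_measure, lintegral_closedBall_inner n he hh]
    simp only [smul_eq_mul, Pi.mul_apply, mul_assoc]

theorem integral_inner_ballUniform {m : ℕ} (hm : m ≠ 0) {e : EuclideanSpace ℝ (Fin m)}
    (he : ‖e‖ = 1) {h : ℝ → ℝ} (hh : Measurable h)
    (hi : IntervalIntegrable (fun θ => h (sin θ) * cos θ ^ m) volume (-(π / 2)) (π / 2)) :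
    Integrable (fun u => h (inner ℝ e u)) (ballUniform m) ∧
      ∫ u, h (inner ℝ e u) ∂(ballUniform m) =
        (∫ θ in (-(π / 2))..(π / 2), h (sin θ) * cos θ ^ m) /
          ∫ θ in (-(π / 2))..(π / 2), cos θ ^ m := by
  obtain ⟨n, rfl⟩ := Nat.exists_eq_succ_of_ne_zero hm
  obtain ⟨c, hc, hmap⟩ := exists_map_inner_ballUniform n
  have hle : -(π / 2) ≤ π / 2 := by linarith [pi_pos]
  have hcos : ∀ᵐ θ ∂(volume.restrict (Ioo (-(π / 2)) (π / 2))), 0 ≤ cos θ ^ (n + 1) := by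
    filter_upwards [ae_restrict_mem measurableSet_Ioo] with θ hθ
    exact pow_nonneg (cos_pos_of_mem_Ioo hθ).le _
  have hin : AEMeasurable (fun u => inner ℝ e u) (ballUniform (n + 1)) := by fun_prop
  have key (g : ℝ → ℝ) (hg : Measurable g) : ∫ u, g (inner ℝ e u) ∂(ballUniform (n + 1)) =
      c.toReal * ∫ θ in (-(π / 2))..(π / 2), g (sin θ) * cos θ ^ (n + 1) := by
    rw [← integral_map hin hg.aestronglyMeasurable, hmap e he,
      integral_smul_measure, integral_map (by fun_prop) hg.aestronglyMeasurable,
      integral_withDensity_eq_integral_toReal_smul (by fun_prop) (by simp),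
      intervalIntegral.integral_of_le hle, integral_Ioc_eq_integral_Ioo, smul_eq_mul]
    congr 1
    refine integral_congr_ae ?_
    filter_upwards [hcos] with θ hθ
    rw [ENNReal.toReal_ofReal hθ, smul_eq_mul, mul_comm]
  constructor
  · have : Integrable h ((ballUniform (n + 1)).map fun u => inner ℝ e u) := by
      rw [hmap e he]
      refine Integrable.smul_measure ?_ hc
      rw [integrable_map_measure hh.aestronglyMeasurable (by fun_prop),
        integrable_withDensity_iff (by fun_prop) (by simp)]
      rw [intervalIntegrable_iff_integrableOn_Ioo_of_le hle] at hi
      refine hi.congr ?_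
      filter_upwards [hcos] with θ hθ
      rw [ENNReal.toReal_ofReal hθ, Function.comp_apply]
    exact this.comp_measurable (by fun_prop)
  · have h1 := key (fun _ => 1) measurable_const
    simp only [integral_const, probReal_univ, smul_eq_mul, one_mul] at h1
    rw [key h hh, eq_div_iff (integral_symm_cos_pow_pos _).ne']
    linear_combination -(∫ θ in (-(π / 2))..(π / 2), h (sin θ) * cos θ ^ (n + 1)) * h1

end Slicing

end CondNumber

namespace CondNumber

/-! ### Means of a linear functional over the ball. -/

section LinearFunctional

open Real

variable {m : ℕ} {ℓ : EuclideanSpace ℝ (Fin m) →L[ℝ] ℝ}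

theorem exists_unit_eq_norm_mul_inner (hℓ : ℓ ≠ 0) :
    ∃ e : EuclideanSpace ℝ (Fin m), ‖e‖ = 1 ∧ ∀ u, ℓ u = ‖ℓ‖ * inner ℝ e u := by
  have hn : ‖ℓ‖ ≠ 0 := norm_ne_zero_iff.2 hℓ
  refine ⟨‖ℓ‖⁻¹ • (InnerProductSpace.toDual ℝ _).symm ℓ, ?_, fun u => ?_⟩
  · rw [norm_smul, LinearIsometryEquiv.norm_map, norm_inv, norm_norm, inv_mul_cancel₀ hn]
  · rw [real_inner_smul_left, InnerProductSpace.toDual_symm_apply, mul_inv_cancel_left₀ hn]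

theorem dim_ne_zero (hℓ : ℓ ≠ 0) : m ≠ 0 := by
  rintro rfl
  exact hℓ (Subsingleton.elim _ _)

theorem ae_mem_closedBall (m : ℕ) :
    ∀ᵐ u ∂(ballUniform m), u ∈ Metric.closedBall (0 : EuclideanSpace ℝ (Fin m)) 1 :=
  ProbabilityTheory.ae_cond_mem measurableSet_closedBall

/-- The kernel is a proper subspace, hence Lebesgue-null. -/
theorem ae_ne_zero (hℓ : ℓ ≠ 0) : ∀ᵐ u ∂(ballUniform m), ℓ u ≠ 0 := by
  have h : volume ((ℓ.toLinearMap.ker : Submodule ℝ _) : Set (EuclideanSpace ℝ (Fin m))) = 0 := by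
    refine Measure.addHaar_submodule _ _ fun h => hℓ ?_
    ext u
    have : u ∈ ℓ.toLinearMap.ker := h ▸ Submodule.mem_top
    simpa using this
  refine ProbabilityTheory.cond_absolutelyContinuous.ae_le (measure_mono_null (fun u hu => ?_) h)
  simpa using hu

theorem integral_abs_ballUniform (hℓ : ℓ ≠ 0) :
    ∫ u, |ℓ u| ∂(ballUniform m) = ‖ℓ‖ * absMean m := by
  obtain ⟨e, he, h⟩ := exists_unit_eq_norm_mul_inner hℓ
  have := (integral_inner_ballUniform (dim_ne_zero hℓ) he (h := fun t => |t|) (by fun_prop)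
    (Continuous.intervalIntegrable (by fun_prop) _ _)).2
  simp only [h, abs_mul, abs_norm]
  rw [integral_const_mul, this, absMean]

theorem integral_log_ballUniform (hℓ : ℓ ≠ 0) :
    Integrable (fun u => log (ℓ u)) (ballUniform m) ∧
      ∫ u, log (ℓ u) ∂(ballUniform m) = log ‖ℓ‖ + logMean m := by
  obtain ⟨e, he, h⟩ := exists_unit_eq_norm_mul_inner hℓ
  obtain ⟨h1, h2⟩ := integral_inner_ballUniform (dim_ne_zero hℓ) he measurable_log
    (intervalIntegrable_log_sin_mul_cos_pow m _ _)
  have hae : (fun u => log (ℓ u)) =ᵐ[ballUniform m] fun u => log ‖ℓ‖ + log (inner ℝ e u) := by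
    filter_upwards [ae_ne_zero hℓ] with u hu
    rw [h u] at hu ⊢
    exact log_mul (left_ne_zero_of_mul hu) (right_ne_zero_of_mul hu)
  refine ⟨(integrable_congr hae).2 ((integrable_const _).add h1), ?_⟩
  rw [integral_congr_ae hae, integral_add (integrable_const _) h1, h2, logMean]
  simp

theorem aemeasurable_ballUniform {g : EuclideanSpace ℝ (Fin m) → ℝ}
    (hg : ContinuousOn g (Metric.closedBall 0 1)) : AEMeasurable g (ballUniform m) :=
  (hg.aemeasurable measurableSet_closedBall).smul_measure _

theorem integrable_ballUniform {g : EuclideanSpace ℝ (Fin m) → ℝ}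
    (hg : ContinuousOn g (Metric.closedBall 0 1)) : Integrable g (ballUniform m) :=
  (hg.integrableOn_compact (isCompact_closedBall 0 1)).smul_measure
    (ENNReal.inv_ne_top.2 (Metric.measure_closedBall_pos _ _ one_pos).ne')

end LinearFunctional

/-! ### Comparison of the law of a perturbed functional with that of the functional. -/

section Perturbation

open scoped ENNReal Pointwise

variable {m : ℕ}

/-- A map close to a linear functional `ℓ` in the Lipschitz sense has, up to a constant factor,
a distribution dominated by that of `2ℓ`. -/
theorem exists_measure_preimage_le {ℓ : EuclideanSpace ℝ (Fin m) →L[ℝ] ℝ} (hℓ : ℓ ≠ 0) :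
    ∃ ε > 0, ∀ g : EuclideanSpace ℝ (Fin m) → ℝ, g 0 = 0 →
      (∀ u ∈ Metric.closedBall 0 1, ∀ v ∈ Metric.closedBall 0 1,
        |g u - g v - ℓ (u - v)| ≤ ε * ‖u - v‖) →
      ∀ T : Set ℝ, ballUniform m (g ⁻¹' T) ≤
        2 ^ (m + 1) * ballUniform m ((fun u => 2 * ℓ u) ⁻¹' T) := by
  obtain ⟨v, hv⟩ : ∃ v, ℓ v ≠ 0 := by
    by_contra! h
    exact hℓ (ContinuousLinearMap.ext h)
  set w := (ℓ v)⁻¹ • v with hw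
  have hℓw : ℓ w = 1 := by simp [hw, hv]
  have hw0 : 0 < ‖w‖ := norm_pos_iff.2 fun h => by simp [h] at hℓw
  -- Since det id = 1 > 1/2, a map close enough to the identity in the Lipschitz sense shrinks no
  -- volume below one half.
  have hev := mul_le_addHaar_image_of_lt_det (volume : Measure (EuclideanSpace ℝ (Fin m)))
    (ContinuousLinearMap.id ℝ _) (m := 2⁻¹) (by
      have : (ContinuousLinearMap.id ℝ (EuclideanSpace ℝ (Fin m))).det = 1 := by
        simp [ContinuousLinearMap.det]
      rw [this]
      simp)
  have hev1 : ∀ᶠ η : NNReal in 𝓝[>] 0, η ≤ 1 :=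
    mem_nhdsWithin_of_mem_nhds (Iic_mem_nhds one_pos)
  obtain ⟨η, ⟨hη, hη1⟩, hη0⟩ := ((hev.and hev1).and self_mem_nhdsWithin).exists
  refine ⟨η / ‖w‖, div_pos (NNReal.coe_pos.2 hη0) hw0, fun g hg0 hg T => ?_⟩
  -- Φ shifts u along w, where ℓ w = 1, so that ℓ (Φ u) = g u: it carries the level sets of g into
  -- those of ℓ.
  let Φ : EuclideanSpace ℝ (Fin m) → EuclideanSpace ℝ (Fin m) := fun u => u + (g u - ℓ u) • w
  have hΦ : ∀ u ∈ Metric.closedBall 0 1, ∀ v ∈ Metric.closedBall 0 1,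
      ‖Φ u - Φ v - (u - v)‖ ≤ η * ‖u - v‖ := by
    intro u hu v hv
    have : Φ u - Φ v - (u - v) = (g u - g v - ℓ (u - v)) • w := by
      simp only [Φ, map_sub]
      module
    rw [this, norm_smul, Real.norm_eq_abs]
    calc _ ≤ η / ‖w‖ * ‖u - v‖ * ‖w‖ := by gcongr; exact hg u hu v hv
      _ = _ := by field_simp
  set B := Metric.closedBall (0 : EuclideanSpace ℝ (Fin m)) 1 with hB
  have hvol := hη (B ∩ g ⁻¹' T) Φ fun u hu v hv => hΦ u hu.1 v hv.1
  -- As η ≤ 1, Φ maps the unit ball into the ball of radius 2. Halving returns to the unit ball,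
  -- whence 2ℓ and a factor 2^m; the volume bound for Φ gives the remaining factor 2.
  have hsub : Φ '' (B ∩ g ⁻¹' T) ⊆ (2 : ℝ) • (B ∩ (fun u => 2 * ℓ u) ⁻¹' T) := by
    rintro _ ⟨u, ⟨hu, huT⟩, rfl⟩
    rw [Set.mem_smul_set_iff_inv_smul_mem₀ two_ne_zero]
    constructor
    · have h0 := hΦ u hu 0 (by simp [hB])
      have hΦ0 : Φ 0 = 0 := by simp [Φ, hg0]
      rw [hB, mem_closedBall_zero_iff] at hu
      have h1 : (η : ℝ) ≤ 1 := by exact_mod_cast hη1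
      have h2 : ‖Φ u‖ ≤ 2 := by
        calc ‖Φ u‖ = ‖(Φ u - Φ 0 - (u - 0)) + u‖ := by rw [hΦ0]; congr 1; module
          _ ≤ η * ‖u - 0‖ + ‖u‖ := (norm_add_le _ _).trans (by gcongr)
          _ ≤ 2 := by rw [sub_zero]; nlinarith [norm_nonneg u, η.coe_nonneg]
      rw [hB, mem_closedBall_zero_iff, norm_smul]
      norm_num
      linarith
    · have : 2 * ℓ ((2 : ℝ)⁻¹ • Φ u) = g u := by
        simp [Φ, hℓw]
        ring
      rw [Set.mem_preimage, this]
      exact huT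
  have hfin : volume (B ∩ g ⁻¹' T) ≤
      2 ^ (m + 1) * volume (B ∩ (fun u => 2 * ℓ u) ⁻¹' T) := by
    have h1 := hvol.trans (measure_mono hsub)
    rw [Measure.addHaar_smul, finrank_euclideanSpace_fin, abs_of_pos (by positivity),
      ENNReal.ofReal_pow zero_le_two, ENNReal.ofReal_ofNat] at h1
    calc volume (B ∩ g ⁻¹' T) = 2 * (((2⁻¹ : NNReal) : ℝ≥0∞) * volume (B ∩ g ⁻¹' T)) := by
          rw [← mul_assoc, ENNReal.coe_inv two_ne_zero, ENNReal.coe_ofNat,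
            ENNReal.mul_inv_cancel two_ne_zero ENNReal.ofNat_ne_top, one_mul]
      _ ≤ 2 * (2 ^ m * volume (B ∩ (fun u => 2 * ℓ u) ⁻¹' T)) := by gcongr
      _ = _ := by ring
  rw [ballUniform, ProbabilityTheory.cond_apply measurableSet_closedBall,
    ProbabilityTheory.cond_apply measurableSet_closedBall, mul_left_comm]
  gcongr

end Perturbation

/-! ### Convergence of logarithmic means. -/

section LogConvergence

open Real

/-- The absolute error of truncating `log |t|` from below at `log s`. -/
noncomputable def logTail (s t : ℝ) : ℝ := |log t - log (max |t| s)|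

theorem measurable_logTail (s : ℝ) : Measurable (logTail s) := by
  unfold logTail
  fun_prop

theorem logTail_le {s t : ℝ} (hs : 0 < s) (hs1 : s ≤ 1) (ht : t ≠ 0) : logTail s t ≤ |log t| := by
  have ht' : 0 < |t| := abs_pos.2 ht
  rw [logTail, ← log_abs t]
  rcases le_total s |t| with h | h
  · simp [max_eq_left h]
  · rw [max_eq_right h]
    have h1 := log_le_log ht' h
    have h2 := log_nonpos hs.le hs1
    rw [abs_of_nonpos (a := log |t| - log s) (by linarith),
      abs_of_nonpos (a := log |t|) (by linarith)]
    linarith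

/-- The logarithm is 1/s-Lipschitz on [s, ∞), and truncation at s does not increase distances. -/
theorem abs_log_max_sub_le {s a b : ℝ} (hs : 0 < s) :
    |log (max |a| s) - log (max |b| s)| ≤ |a - b| / s := by
  have key : ∀ p q : ℝ, s ≤ p → s ≤ q → log p - log q ≤ |p - q| / s := by
    intro p q hp hq
    have hp0 := hs.trans_le hp
    have hq0 := hs.trans_le hq
    rw [← log_div hp0.ne' hq0.ne']
    calc log (p / q) ≤ p / q - 1 := log_le_sub_one_of_pos (by positivity)
      _ = (p - q) / q := by field_simp
      _ ≤ |p - q| / q := by gcongr; exact le_abs_self _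
      _ ≤ |p - q| / s := by gcongr
  have hmax : |max |a| s - max |b| s| ≤ |a - b| :=
    (abs_max_sub_max_le_abs _ _ _).trans (abs_abs_sub_abs_le_abs_sub a b)
  have hle : |max |a| s - max |b| s| / s ≤ |a - b| / s := by gcongr
  refine abs_sub_le_iff.2 ⟨(key _ _ (le_max_right _ _) (le_max_right _ _)).trans hle, ?_⟩
  refine (key _ _ (le_max_right _ _) (le_max_right _ _)).trans ?_
  rwa [abs_sub_comm]

variable {m : ℕ}

theorem tendsto_integral_logTail {ℓ : EuclideanSpace ℝ (Fin m) →L[ℝ] ℝ} (hℓ : ℓ ≠ 0) :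
    Tendsto (fun s => ∫ u, logTail s (ℓ u) ∂(ballUniform m)) (𝓝[>] 0) (𝓝 0) := by
  have hs1 : ∀ᶠ s : ℝ in 𝓝[>] 0, s ≤ 1 := mem_nhdsWithin_of_mem_nhds (Iic_mem_nhds one_pos)
  have h := tendsto_integral_filter_of_dominated_convergence (μ := ballUniform m)
    (l := 𝓝[>] (0 : ℝ)) (F := fun s u => logTail s (ℓ u)) (f := fun _ => 0)
    (fun u => |log (ℓ u)|) ?_ ?_ (integral_log_ballUniform hℓ).1.abs ?_
  · simpa using h
  · exact Eventually.of_forall fun s =>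
      ((measurable_logTail s).comp ℓ.continuous.measurable).aestronglyMeasurable
  · filter_upwards [hs1, self_mem_nhdsWithin] with s hs1 hs0
    filter_upwards [ae_ne_zero hℓ] with u hu
    rw [norm_eq_abs, logTail, abs_abs]
    exact logTail_le hs0 hs1 hu
  · filter_upwards [ae_ne_zero hℓ] with u hu
    refine tendsto_const_nhds.congr' ?_
    filter_upwards [mem_nhdsWithin_of_mem_nhds (Iic_mem_nhds (abs_pos.2 hu))] with s hs
    rw [logTail, max_eq_left hs, log_abs, sub_self, abs_zero]

/-- Truncate both logarithms at level s. The truncated parts are uniformly close. The tail of ℓ is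
small by dominated convergence, and that of G i is at most 2^(m+1) times the tail of 2ℓ, a bound
independent of i. -/
theorem tendsto_integral_log {ι : Type*} {l : Filter ι} {ℓ : EuclideanSpace ℝ (Fin m) →L[ℝ] ℝ}
    (hℓ : ℓ ≠ 0) {G : ι → EuclideanSpace ℝ (Fin m) → ℝ}
    (hcont : ∀ᶠ i in l, ContinuousOn (G i) (Metric.closedBall 0 1))
    (hzero : ∀ i, G i 0 = 0)
    (hG : ∀ ε > 0, ∀ᶠ i in l, ∀ u ∈ Metric.closedBall 0 1, ∀ v ∈ Metric.closedBall 0 1,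
      |G i u - G i v - ℓ (u - v)| ≤ ε * ‖u - v‖) :
    (∀ᶠ i in l, (∀ᵐ u ∂(ballUniform m), G i u ≠ 0) ∧
      Integrable (fun u => log (G i u)) (ballUniform m)) ∧
    Tendsto (fun i => ∫ u, log (G i u) ∂(ballUniform m)) l
      (𝓝 (∫ u, log (ℓ u) ∂(ballUniform m))) := by
  obtain ⟨ε, hε, hdom⟩ := exists_measure_preimage_le hℓ
  have h2ℓ : (2 : ℝ) • ℓ ≠ 0 := smul_ne_zero two_ne_zero hℓ
  have h2ℓm : Measurable fun u => 2 * ℓ u := by fun_prop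
  have hle : ∀ᶠ i in l, AEMeasurable (G i) (ballUniform m) ∧ (ballUniform m).map (G i) ≤
      (2 ^ (m + 1) : ENNReal) • (ballUniform m).map fun u => 2 * ℓ u := by
    filter_upwards [hcont, hG ε hε] with i hi hGi
    have hm := aemeasurable_ballUniform hi
    refine ⟨hm, Measure.le_iff.2 fun T hT => ?_⟩
    rw [Measure.map_apply_of_aemeasurable hm hT, Measure.smul_apply,
      Measure.map_apply h2ℓm hT, smul_eq_mul]
    exact hdom _ (hzero i) hGi T
  have hC : (2 ^ (m + 1) : ENNReal) ≠ ⊤ := by finiteness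
  have hilog : Integrable log ((2 ^ (m + 1) : ENNReal) • (ballUniform m).map fun u => 2 * ℓ u) := by
    refine Integrable.smul_measure ?_ hC
    rw [integrable_map_measure measurable_log.aestronglyMeasurable h2ℓm.aemeasurable]
    exact (integral_log_ballUniform h2ℓ).1
  have hne : ∀ᵐ t ∂((2 ^ (m + 1) : ENNReal) • (ballUniform m).map fun u => 2 * ℓ u), t ≠ 0 := by
    refine Measure.ae_smul_measure ?_ _
    exact (ae_map_iff h2ℓm.aemeasurable (measurableSet_singleton (0 : ℝ)).compl).2 (ae_ne_zero h2ℓ)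
  have htail (s : ℝ) (hs : 0 < s) (hs1 : s ≤ 1) : Integrable (logTail s)
      ((2 ^ (m + 1) : ENNReal) • (ballUniform m).map fun u => 2 * ℓ u) := by
    refine hilog.mono (measurable_logTail s).aestronglyMeasurable ?_
    filter_upwards [hne] with t ht
    rw [norm_eq_abs, logTail, abs_abs]
    exact logTail_le hs hs1 ht
  have hreg : ∀ᶠ i in l, (∀ᵐ u ∂(ballUniform m), G i u ≠ 0) ∧
      Integrable (fun u => log (G i u)) (ballUniform m) := by
    filter_upwards [hle] with i ⟨hm, hi⟩
    constructor
    · exact ae_of_ae_map hm (ae_mono hi hne)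
    · exact (hilog.mono_measure hi).comp_aemeasurable hm
  refine ⟨hreg, ?_⟩
  rw [Metric.tendsto_nhds]
  intro r hr
  have ht1 := (tendsto_integral_logTail h2ℓ).const_mul ((2 : ℝ) ^ (m + 1))
  have ht2 := tendsto_integral_logTail hℓ
  rw [mul_zero] at ht1
  have hs1 : ∀ᶠ s : ℝ in 𝓝[>] 0, s ≤ 1 := mem_nhdsWithin_of_mem_nhds (Iic_mem_nhds one_pos)
  have hr3 : 0 < r / 3 := by positivity
  obtain ⟨s, ⟨⟨hsa, hsb⟩, hs1⟩, hs0⟩ := (((ht1.eventually (gt_mem_nhds hr3)).and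
    (ht2.eventually (gt_mem_nhds hr3))).and hs1 |>.and self_mem_nhdsWithin).exists
  have hs0 : 0 < s := hs0
  have hlogℓ := (integral_log_ballUniform hℓ).1
  have htrunc (g : EuclideanSpace ℝ (Fin m) → ℝ)
      (hg : ContinuousOn g (Metric.closedBall 0 1)) :
      Integrable (fun u => log (max |g u| s)) (ballUniform m) :=
    integrable_ballUniform (ContinuousOn.log (by fun_prop)
      fun u _ => (hs0.trans_le (le_max_right _ _)).ne')
  -- The truncated logarithm has Lipschitz constant 1/s, so the tolerance r * s / 3 costs at most r
  -- / 3.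
  filter_upwards [hle, hreg, hcont, hG (r * s / 3) (by positivity)] with i ⟨hm, hi⟩ hri hci hGi
  have b1 : |∫ u, (log (G i u) - log (max |G i u| s)) ∂(ballUniform m)| < r / 3 := by
    refine lt_of_le_of_lt ?_ hsa
    refine abs_integral_le_integral_abs.trans ?_
    have e1 : ∫ u, |log (G i u) - log (max |G i u| s)| ∂(ballUniform m) =
        ∫ t, logTail s t ∂((ballUniform m).map (G i)) :=
      (integral_map hm (measurable_logTail s).aestronglyMeasurable).symm
    rw [e1]
    refine (integral_mono_measure (f := logTail s) hi (Eventually.of_forall fun t => abs_nonneg _)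
      (htail s hs0 hs1)).trans_eq ?_
    rw [integral_smul_measure,
      integral_map h2ℓm.aemeasurable (measurable_logTail s).aestronglyMeasurable]
    simp
  have b2 : |∫ u, (log (ℓ u) - log (max |ℓ u| s)) ∂(ballUniform m)| < r / 3 :=
    lt_of_le_of_lt abs_integral_le_integral_abs hsb
  have b3 : |∫ u, (log (max |G i u| s) - log (max |ℓ u| s)) ∂(ballUniform m)| ≤ r / 3 := by
    have := norm_integral_le_of_norm_le_const (μ := ballUniform m) (C := r / 3)
      (f := fun u => log (max |G i u| s) - log (max |ℓ u| s)) (by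
        filter_upwards [ae_mem_closedBall m] with u hu
        refine (abs_log_max_sub_le hs0).trans ?_
        have h0 := hGi u hu 0 (by simp)
        rw [hzero, sub_zero, sub_zero] at h0
        have hu1 : ‖u‖ ≤ 1 := by simpa using hu
        rw [div_le_iff₀ hs0]
        calc |G i u - ℓ u| ≤ r * s / 3 * ‖u‖ := h0
          _ ≤ r * s / 3 * 1 := by gcongr
          _ = r / 3 * s := by ring)
    simpa using this
  rw [integral_sub hri.2 (htrunc _ hci)] at b1
  rw [integral_sub hlogℓ (htrunc _ ℓ.continuous.continuousOn)] at b2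
  rw [integral_sub (htrunc _ hci) (htrunc _ ℓ.continuous.continuousOn)] at b3
  rw [Real.dist_eq]
  rw [abs_lt] at *
  rw [abs_le] at b3
  constructor <;> linarith [b1.1, b1.2, b2.1, b2.2, b3.1, b3.2]

end LogConvergence

end CondNumber

namespace CondNumber

/-! ### Passage to the unit ball and the three limits. -/

section Rescaling

variable {m : ℕ}

theorem perturbations_eq_closedBall (x : EuclideanSpace ℝ (Fin m)) (δ : ℝ) :
    perturbations x δ = Metric.closedBall x (δ * ‖x‖) := by
  ext y
  simp [perturbations, dist_eq_norm]

theorem cond_closedBall_eq_map (x : EuclideanSpace ℝ (Fin m)) {r : ℝ} (hr : 0 < r) :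
    ProbabilityTheory.cond volume (Metric.closedBall x r) =
      (ballUniform m).map fun u => x + r • u := by
  have hvol (s : Set (EuclideanSpace ℝ (Fin m))) :
      volume ((fun u => x + r • u) ⁻¹' s) = ENNReal.ofReal (r ^ m)⁻¹ * volume s := by
    have : (fun u => x + r • u) ⁻¹' s = (r • ·) ⁻¹' ((x + ·) ⁻¹' s) := rfl
    rw [this, Measure.addHaar_preimage_smul _ hr.ne', measure_preimage_add,
      finrank_euclideanSpace_fin, abs_of_pos (by positivity)]
  have hball : (fun u => x + r • u) ⁻¹' Metric.closedBall x r = Metric.closedBall 0 1 := by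
    ext u
    simp [norm_smul, abs_of_pos hr, hr]
  have hpos : 0 < (r ^ m)⁻¹ := by positivity
  ext s hs
  rw [Measure.map_apply (by fun_prop) hs, ballUniform,
    ProbabilityTheory.cond_apply measurableSet_closedBall,
    ProbabilityTheory.cond_apply measurableSet_closedBall, ← hball, ← Set.preimage_inter,
    hvol, hvol,
    ENNReal.mul_inv (Or.inl (by simpa using hpos)) (Or.inl ENNReal.ofReal_ne_top)]
  rw [mul_mul_mul_comm, ENNReal.inv_mul_cancel (by simpa using hpos) ENNReal.ofReal_ne_top, one_mul]

/-- The signed relative error of the output, divided by `δ`, in the coordinates in which the set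
of perturbations is the unit ball. -/
noncomputable def scaledError (f : EuclideanSpace ℝ (Fin m) → ℝ) (x : EuclideanSpace ℝ (Fin m))
    (δ : ℝ) (u : EuclideanSpace ℝ (Fin m)) : ℝ :=
  (f (x + (δ * ‖x‖) • u) - f x) / (δ * f x)

variable {f : EuclideanSpace ℝ (Fin m) → ℝ} {x : EuclideanSpace ℝ (Fin m)} {δ : ℝ}

theorem relError_eq_abs_scaledError (hδ : 0 < δ) (u : EuclideanSpace ℝ (Fin m)) :
    relError f x δ (x + (δ * ‖x‖) • u) = |scaledError f x δ u| := by
  simp [relError, scaledError, abs_div, abs_mul, abs_of_pos hδ]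

theorem measurableEmbedding_rescale (hx : x ≠ 0) (hδ : 0 < δ) :
    MeasurableEmbedding fun u : EuclideanSpace ℝ (Fin m) => x + (δ * ‖x‖) • u :=
  (measurableEmbedding_addLeft x).comp
    (measurableEmbedding_const_smul₀ (mul_pos hδ (norm_pos_iff.2 hx)).ne')

theorem uniformPerturbation_eq_map (hx : x ≠ 0) (hδ : 0 < δ) :
    uniformPerturbation x δ = (ballUniform m).map fun u => x + (δ * ‖x‖) • u := by
  rw [uniformPerturbation, perturbations_eq_closedBall,
    cond_closedBall_eq_map x (mul_pos hδ (norm_pos_iff.2 hx))]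

theorem integrable_uniformPerturbation_iff (hx : x ≠ 0) (hδ : 0 < δ) (h : ℝ → ℝ) :
    Integrable (fun x' => h (relError f x δ x')) (uniformPerturbation x δ) ↔
      Integrable (fun u => h |scaledError f x δ u|) (ballUniform m) := by
  rw [uniformPerturbation_eq_map hx hδ, (measurableEmbedding_rescale hx hδ).integrable_map_iff]
  simp only [Function.comp_def, relError_eq_abs_scaledError hδ]

theorem integral_uniformPerturbation (hx : x ≠ 0) (hδ : 0 < δ) (h : ℝ → ℝ) :
    ∫ x', h (relError f x δ x') ∂(uniformPerturbation x δ) =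
      ∫ u, h |scaledError f x δ u| ∂(ballUniform m) := by
  rw [uniformPerturbation_eq_map hx hδ, (measurableEmbedding_rescale hx hδ).integral_map]
  simp only [relError_eq_abs_scaledError hδ]

theorem iSup_perturbations (hx : x ≠ 0) (hδ : 0 < δ) :
    ⨆ x' ∈ perturbations x δ, (relError f x δ x' : EReal) =
      ⨆ u ∈ Metric.closedBall (0 : EuclideanSpace ℝ (Fin m)) 1,
        ((|scaledError f x δ u| : ℝ) : EReal) := by
  have hr : 0 < δ * ‖x‖ := mul_pos hδ (norm_pos_iff.2 hx)
  apply le_antisymm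
  · refine iSup₂_le fun y hy => ?_
    have hy' : x + (δ * ‖x‖) • ((δ * ‖x‖)⁻¹ • (y - x)) = y := by
      rw [smul_inv_smul₀ hr.ne', add_sub_cancel]
    have hmem : (δ * ‖x‖)⁻¹ • (y - x) ∈ Metric.closedBall (0 : EuclideanSpace ℝ (Fin m)) 1 := by
      rw [mem_closedBall_zero_iff, norm_smul, norm_inv, Real.norm_of_nonneg hr.le,
        inv_mul_le_iff₀ hr, mul_one]
      exact hy
    refine le_iSup₂_of_le _ hmem ?_
    rw [← relError_eq_abs_scaledError hδ, hy']
  · refine iSup₂_le fun u hu => ?_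
    refine le_iSup₂_of_le (x + (δ * ‖x‖) • u) ?_ ?_
    · rw [mem_closedBall_zero_iff] at hu
      simp only [perturbations, Set.mem_ofPred_eq, add_sub_cancel_left, norm_smul,
        Real.norm_of_nonneg hr.le]
      exact mul_le_of_le_one_right hr.le hu
    · rw [relError_eq_abs_scaledError hδ]

theorem eventually_forall_rescale (x : EuclideanSpace ℝ (Fin m)) {p : EuclideanSpace ℝ (Fin m) → Prop}
    (hp : ∀ᶠ y in 𝓝 x, p y) :
    ∀ᶠ δ : ℝ in 𝓝[>] 0, ∀ u ∈ Metric.closedBall (0 : EuclideanSpace ℝ (Fin m)) 1,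
      p (x + (δ * ‖x‖) • u) := by
  obtain ⟨r, hr, h⟩ := Metric.eventually_nhds_iff.1 hp
  have ht : Tendsto (fun δ : ℝ => δ * ‖x‖) (𝓝[>] 0) (𝓝 0) := by
    have : Tendsto (fun δ : ℝ => δ * ‖x‖) (𝓝 0) (𝓝 (0 * ‖x‖)) := tendsto_id.mul_const _
    rw [zero_mul] at this
    exact this.mono_left nhdsWithin_le_nhds
  filter_upwards [ht.eventually (gt_mem_nhds hr), self_mem_nhdsWithin] with δ hδ hδ0 u hu
  have hδ0 : 0 < δ := hδ0
  apply h
  rw [mem_closedBall_zero_iff] at hu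
  rw [dist_eq_norm, add_sub_cancel_left, norm_smul, Real.norm_of_nonneg (by positivity)]
  exact (mul_le_of_le_one_right (by positivity) hu).trans_lt hδ

theorem eventually_continuousOn_scaledError (hf : ∀ᶠ y in 𝓝 x, DifferentiableAt ℝ f y) :
    ∀ᶠ δ : ℝ in 𝓝[>] 0, ContinuousOn (scaledError f x δ) (Metric.closedBall 0 1) := by
  filter_upwards [eventually_forall_rescale x hf] with δ hδ u hu
  have h1 : ContinuousAt (fun u => f (x + (δ * ‖x‖) • u)) u :=
    ContinuousAt.comp (f := fun u : EuclideanSpace ℝ (Fin m) => x + (δ * ‖x‖) • u)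
      (hδ u hu).continuousAt (by fun_prop)
  exact ((h1.sub continuousAt_const).div_const _).continuousWithinAt

theorem scaledError_sub (hδ : δ ≠ 0) (hfx : f x ≠ 0) (u v : EuclideanSpace ℝ (Fin m)) :
    scaledError f x δ u - scaledError f x δ v - ((‖x‖ / f x) • fderiv ℝ f x) (u - v) =
      (f (x + (δ * ‖x‖) • u) - f (x + (δ * ‖x‖) • v) -
        fderiv ℝ f x ((x + (δ * ‖x‖) • u) - (x + (δ * ‖x‖) • v))) / (δ * f x) := by
  rw [add_sub_add_left_eq_sub, ← smul_sub, map_smul]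
  simp only [scaledError, smul_apply, smul_eq_mul]
  field_simp
  ring

theorem abs_scaledError_sub_le (hx : x ≠ 0) (hδ : 0 < δ) (hfx : f x ≠ 0) {ε : ℝ}
    {u v : EuclideanSpace ℝ (Fin m)}
    (h : ‖f (x + (δ * ‖x‖) • u) - f (x + (δ * ‖x‖) • v) -
        fderiv ℝ f x ((x + (δ * ‖x‖) • u) - (x + (δ * ‖x‖) • v))‖ ≤
      ε * |f x| / ‖x‖ * ‖(x + (δ * ‖x‖) • u) - (x + (δ * ‖x‖) • v)‖) :
    |scaledError f x δ u - scaledError f x δ v - ((‖x‖ / f x) • fderiv ℝ f x) (u - v)| ≤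
      ε * ‖u - v‖ := by
  have hx' : 0 < ‖x‖ := norm_pos_iff.2 hx
  have hfx' : 0 < |f x| := abs_pos.2 hfx
  rw [scaledError_sub hδ.ne' hfx, abs_div, abs_mul, abs_of_pos hδ, div_le_iff₀ (by positivity)]
  refine h.trans_eq ?_
  rw [add_sub_add_left_eq_sub, ← smul_sub, norm_smul, Real.norm_of_nonneg (by positivity)]
  field_simp

theorem scaledError_zero : scaledError f x δ 0 = 0 := by
  simp [scaledError]

/-- Differentiability at x compares only with the centre u = 0; this suffices for the limits of
suprema and of mean absolute values. -/
theorem eventually_abs_scaledError_sub_linear_le (hf : DifferentiableAt ℝ f x) (hx : x ≠ 0)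
    (hfx : f x ≠ 0) {ε : ℝ} (hε : 0 < ε) :
    ∀ᶠ δ : ℝ in 𝓝[>] 0, ∀ u ∈ Metric.closedBall (0 : EuclideanSpace ℝ (Fin m)) 1,
      |scaledError f x δ u - ((‖x‖ / f x) • fderiv ℝ f x) u| ≤ ε := by
  have hx' : 0 < ‖x‖ := norm_pos_iff.2 hx
  have hfx' : 0 < |f x| := abs_pos.2 hfx
  have hε' : 0 < ε * |f x| / ‖x‖ := by positivity
  filter_upwards [eventually_forall_rescale x (hf.hasFDerivAt.isLittleO.def hε'),
    self_mem_nhdsWithin] with δ h hδ u hu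
  have := abs_scaledError_sub_le (v := 0) hx hδ hfx (by simpa using h u hu)
  rw [scaledError_zero, sub_zero, sub_zero] at this
  rw [mem_closedBall_zero_iff] at hu
  exact this.trans (mul_le_of_le_one_right hε.le hu)

/-- Strict differentiability controls pairs u, v, giving the Lipschitz closeness that
`tendsto_integral_log` needs. -/
theorem eventually_abs_scaledError_sub_le (hf : HasStrictFDerivAt f (fderiv ℝ f x) x) (hx : x ≠ 0)
    (hfx : f x ≠ 0) {ε : ℝ} (hε : 0 < ε) :
    ∀ᶠ δ : ℝ in 𝓝[>] 0, ∀ u ∈ Metric.closedBall (0 : EuclideanSpace ℝ (Fin m)) 1,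
      ∀ v ∈ Metric.closedBall (0 : EuclideanSpace ℝ (Fin m)) 1,
      |scaledError f x δ u - scaledError f x δ v - ((‖x‖ / f x) • fderiv ℝ f x) (u - v)| ≤
        ε * ‖u - v‖ := by
  have hx' : 0 < ‖x‖ := norm_pos_iff.2 hx
  have hfx' : 0 < |f x| := abs_pos.2 hfx
  have hε' : 0 < ε * |f x| / ‖x‖ := by positivity
  have h2 := hf.isLittleO.def hε'
  rw [nhds_prod_eq, eventually_prod_self_iff'] at h2
  obtain ⟨t, ht, h2⟩ := h2
  filter_upwards [eventually_forall_rescale x ht, self_mem_nhdsWithin] with δ h hδ u hu v hv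
  exact abs_scaledError_sub_le hx hδ hfx (h2 _ (h u hu) _ (h v hv))

/-- The upper bound is the operator norm bound on the ball; the lower bound tests the unit vector e
with ℓ e = ‖ℓ‖. -/
theorem hasWNC_norm (hf : DifferentiableAt ℝ f x) (hx : x ≠ 0) (hfx : f x ≠ 0)
    (hdf : fderiv ℝ f x ≠ 0) : HasWNC f x ‖(‖x‖ / f x) • fderiv ℝ f x‖ := by
  have hℓ : (‖x‖ / f x) • fderiv ℝ f x ≠ 0 :=
    smul_ne_zero (div_ne_zero (norm_ne_zero_iff.2 hx) hfx) hdf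
  have hclose (ε : ℝ) (hε : 0 < ε) := eventually_abs_scaledError_sub_linear_le hf hx hfx hε
  generalize (‖x‖ / f x) • fderiv ℝ f x = ℓ at *
  obtain ⟨e, he, heℓ⟩ := exists_unit_eq_norm_mul_inner hℓ
  have hℓe : ℓ e = ‖ℓ‖ := by rw [heℓ, real_inner_self_eq_norm_sq, he]; simp
  rw [HasWNC, tendsto_order]
  constructor
  · intro a ha
    obtain ⟨b, hab, hb⟩ := EReal.lt_iff_exists_real_btwn.1 ha
    have hb' : 0 < ‖ℓ‖ - b := sub_pos.2 (EReal.coe_lt_coe_iff.1 hb)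
    filter_upwards [hclose _ hb', self_mem_nhdsWithin] with δ h hδ
    have heB : e ∈ Metric.closedBall (0 : EuclideanSpace ℝ (Fin m)) 1 := by simp [he]
    rw [iSup_perturbations hx hδ]
    refine hab.trans_le (le_iSup₂_of_le e heB (EReal.coe_le_coe_iff.2 ?_))
    have := h e heB
    rw [hℓe] at this
    linarith [(abs_le.1 this).1, le_abs_self (scaledError f x δ e)]
  · intro a ha
    obtain ⟨b, hb, hba⟩ := EReal.lt_iff_exists_real_btwn.1 ha
    have hb' : 0 < b - ‖ℓ‖ := sub_pos.2 (EReal.coe_lt_coe_iff.1 hb)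
    filter_upwards [hclose _ hb', self_mem_nhdsWithin] with δ h hδ
    rw [iSup_perturbations hx hδ]
    refine lt_of_le_of_lt (iSup₂_le fun u hu => EReal.coe_le_coe_iff.2 ?_) hba
    have h1 := h u hu
    have h2 : |ℓ u| ≤ ‖ℓ‖ := ℓ.unit_le_opNorm u (by simpa using hu)
    have h3 := abs_sub_abs_le_abs_sub (scaledError f x δ u) (ℓ u)
    linarith

theorem hasSNC_integral (hf : ∀ᶠ y in 𝓝 x, DifferentiableAt ℝ f y) (hx : x ≠ 0) (hfx : f x ≠ 0) :
    HasSNC f x (∫ u, |((‖x‖ / f x) • fderiv ℝ f x) u| ∂(ballUniform m)) := by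
  have hcont := eventually_continuousOn_scaledError hf
  have hint {g : EuclideanSpace ℝ (Fin m) → ℝ} (hg : ContinuousOn g (Metric.closedBall 0 1)) :
      Integrable (fun u => |g u|) (ballUniform m) := integrable_ballUniform hg.abs
  constructor
  · filter_upwards [hcont, self_mem_nhdsWithin] with δ hc hδ
    exact (integrable_uniformPerturbation_iff hx hδ id).2 (hint hc)
  · rw [Metric.tendsto_nhds]
    intro r hr
    filter_upwards [hcont, self_mem_nhdsWithin,
      eventually_abs_scaledError_sub_linear_le hf.self_of_nhds hx hfx (half_pos hr)] with δ hc hδ h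
    have e := integral_uniformPerturbation (f := f) hx hδ id
    simp only [id] at e
    rw [e, dist_eq_norm, ← integral_sub (hint hc)
      (hint (ContinuousLinearMap.continuous _).continuousOn)]
    refine (norm_integral_le_of_norm_le_const (C := r / 2) ?_).trans_lt ?_
    · filter_upwards [ae_mem_closedBall m] with u hu
      exact (abs_abs_sub_abs_le_abs_sub _ _).trans (h u hu)
    · simp [hr]

theorem hasSNLP_integral (hf : HasStrictFDerivAt f (fderiv ℝ f x) x)
    (hf' : ∀ᶠ y in 𝓝 x, DifferentiableAt ℝ f y) (hx : x ≠ 0) (hfx : f x ≠ 0)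
    (hdf : fderiv ℝ f x ≠ 0) :
    HasSNLP f x
      ((∫ u, Real.log (((‖x‖ / f x) • fderiv ℝ f x) u) ∂(ballUniform m)) / Real.log 2) := by
  have hℓ : (‖x‖ / f x) • fderiv ℝ f x ≠ 0 :=
    smul_ne_zero (div_ne_zero (norm_ne_zero_iff.2 hx) hfx) hdf
  obtain ⟨h1, h2⟩ := tendsto_integral_log hℓ (eventually_continuousOn_scaledError hf')
    (fun δ => scaledError_zero) fun ε hε => eventually_abs_scaledError_sub_le hf hx hfx hε
  constructor
  · filter_upwards [h1, self_mem_nhdsWithin] with δ h hδ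
    constructor
    · rw [uniformPerturbation_eq_map hx hδ, (measurableEmbedding_rescale hx hδ).ae_map_iff]
      filter_upwards [h.1] with u hu
      rwa [relError_eq_abs_scaledError hδ, abs_ne_zero]
    · rw [integrable_uniformPerturbation_iff hx hδ (Real.logb 2)]
      simp only [Real.logb, Real.log_abs]
      exact h.2.div_const _
  · refine (h2.div_const (Real.log 2)).congr' ?_
    filter_upwards [self_mem_nhdsWithin] with δ hδ
    rw [integral_uniformPerturbation hx hδ (Real.logb 2)]
    simp only [Real.logb, Real.log_abs]
    rw [integral_div]

end Rescaling

end CondNumber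

theorem corollary1 {m : ℕ} (f : EuclideanSpace ℝ (Fin m) → ℝ) (x : EuclideanSpace ℝ (Fin m))
    (hf : ∀ᶠ y in 𝓝 x, DifferentiableAt ℝ f y)
    (hx : x ≠ 0) (hfx : f x ≠ 0) (hdf : fderiv ℝ f x ≠ 0) :
    ∃ W S : ℝ, CondNumber.HasWNC f x W ∧ CondNumber.HasSNC f x S ∧ 0 < W ∧
      (Odd m → S / W = (m‼ : ℝ) / ((m + 1)‼ : ℝ)) ∧
      (Even m → S / W = (m‼ : ℝ) / ((m + 1)‼ : ℝ) * (2 / Real.pi)) ∧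
      (ContinuousAt (fderiv ℝ f) x →
        ∃ L : ℝ, CondNumber.HasSNLP f x L ∧
          (Odd m → (L - Real.logb 2 W) / Real.logb 2 (Real.exp 1) =
            -∑ k ∈ (Finset.Icc 1 m).filter Odd, 1 / (k : ℝ)) ∧
          (Even m → (L - Real.logb 2 W) / Real.logb 2 (Real.exp 1) =
            -(∑ k ∈ (Finset.Icc 1 m).filter Even, 1 / (k : ℝ)) - Real.log 2)) := by
  have hℓ : (‖x‖ / f x) • fderiv ℝ f x ≠ 0 :=
    smul_ne_zero (div_ne_zero (norm_ne_zero_iff.2 hx) hfx) hdf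
  have hW : 0 < ‖(‖x‖ / f x) • fderiv ℝ f x‖ := norm_pos_iff.2 hℓ
  refine ⟨‖(‖x‖ / f x) • fderiv ℝ f x‖, _, CondNumber.hasWNC_norm hf.self_of_nhds hx hfx hdf,
    CondNumber.hasSNC_integral hf hx hfx, hW, ?_, ?_, fun hc => ⟨_, CondNumber.hasSNLP_integral
      (hasStrictFDerivAt_of_hasFDerivAt_of_continuousAt (hf.mono fun y hy => hy.hasFDerivAt) hc)
      hf hx hfx hdf, ?_⟩⟩
  · intro hm
    rw [CondNumber.integral_abs_ballUniform hℓ, mul_div_cancel_left₀ _ hW.ne',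
      CondNumber.absMean_of_odd hm]
  · intro hm
    rw [CondNumber.integral_abs_ballUniform hℓ, mul_div_cancel_left₀ _ hW.ne',
      CondNumber.absMean_of_even hm]
  · have hlog2 : Real.log 2 ≠ 0 := (Real.log_pos one_lt_two).ne'
    -- The term log ‖ℓ‖ cancels against log W, and dividing by log₂ e = 1 / ln 2 turns bits into
    -- natural units, leaving `logMean m`.
    rw [(CondNumber.integral_log_ballUniform hℓ).2, Real.logb, Real.logb, Real.log_exp, ← sub_div,
      add_sub_cancel_left, div_div_div_cancel_right₀ hlog2, div_one]
    exact ⟨CondNumber.logMean_of_odd, CondNumber.logMean_of_even⟩
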